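/- Let $G$ be a finite group, let $\{G^\lambda \mid \lambda\in\Lambda(G)\}$ be a complete set of pairwise non-isomorphic irreducible finite-dimensional $G$-modules over $\mathbb{C}$, and let $0\in\Lambda(G)$ be the index of the one-dimensional trivial module. Let $V$ be a finite-dimensional complex $G$-module on which $G$ acts faithfully and which is isomorphic, as a $G$-module, to its dual $V^*$; let $\chi_V$ be its character. Let $\mathrm{A}=(a_{\mu,\lambda})_{\mu,\lambda\in\Lambda(G)}$ be the adjacency matrix of the representation graph $\mathcal{R}_V(G)$, that is, $a_{\mu,\lambda}$ is the multiplicity of $G^\lambda$ as a summand of $G^\mu\otimes V$, so that $G^\mu\otimes V\cong\bigoplus_{\lambda} a_{\mu,\lambda}G^\lambda$. For $\mu\in\Lambda(G)$ let $m^\mu(t)=\sum_{k\ge 0} m^\mu_k t^k\in\mathbb{C}[[t]]$, where $m_k^\mu$ is the multiplicity of $G^\mu$ in $V^{\otimes k}$ (with $V^{\otimes 0}=\mathbb{C}$ the trivial module), and let $\mathrm{M}^\mu$ be the matrix obtained from $\mathrm{I}-t\mathrm{A}$ by replacing the column indexed by $\mu$ by the column vector $e_0$ with entry $1$ in position $0$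 and $0$ elsewhere. Let $\Gamma\subseteq G$ be a set of representatives of the conjugacy classes of $G$. Then $\Lambda(G)$ is finite, $\det(\mathrm{I}-t\mathrm{A})$ is invertible in $\mathbb{C}[[t]]$, $$\det(\mathrm{I}-t\mathrm{A})=\prod_{g\in\Gamma}\bigl(1-\chi_V(g)\,t\bigr),$$ and, for every $\mu\in\Lambda(G)$, $$m^\mu(t)=\frac{\det(\mathrm{M}^\mu)}{\det(\mathrm{I}-t\mathrm{A})}=\frac{\det(\mathrm{M}^\mu)}{\prod_{g\in\Gamma}\bigl(1-\chi_V(g)\,t\bigr)}.$$ -/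

import Mathlib

noncomputable section

namespace PoincareTensor

/-- The `G`-module `V^{⊗k}`, on which `g` acts by `v₁ ⊗ ⋯ ⊗ vₖ ↦ g v₁ ⊗ ⋯ ⊗ g vₖ`.
For `k = 0` this is the trivial one-dimensional module. -/
def tensorPower {G V : Type*} [Group G] [AddCommGroup V] [Module ℂ V]
    (ρ : Representation ℂ G V) (k : ℕ) : Representation ℂ G (TensorPower ℂ k V) where
  toFun g := PiTensorProduct.map fun _ => ρ g
  map_one' := by
    simp only [map_one]
    exact PiTensorProduct.map_one
  map_mul' g h := by
    simp only [map_mul]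
    exact PiTensorProduct.map_mul (fun _ => ρ g) (fun _ => ρ h)

/-- The family `(σ i)` lists the finite-dimensional irreducible complex `G`-modules: each `σ i` is
irreducible, and each finite-dimensional irreducible module is isomorphic to `σ i` for exactly one
index `i`. (A nonzero finite-dimensional complex vector space has a basis, so every module is
isomorphic to one on a coordinate space `ℂⁿ`, in whatever universe it lives; it is therefore
enough to name the modules on `ℂⁿ`.) -/
structure IsIrreducibleList {G : Type*} [Group G] {Lam : Type*} {S : Lam → Type*}
    [∀ i, AddCommGroup (S i)] [∀ i, Module ℂ (S i)]
    (σ : ∀ i, Representation ℂ G (S i)) : Prop where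
  finiteDimensional : ∀ i, FiniteDimensional ℂ (S i)
  irreducible : ∀ i, (σ i).IsIrreducible
  eq_of_equiv : ∀ i j, Nonempty ((σ i).Equiv (σ j)) → i = j
  exists_equiv : ∀ (n : ℕ) (τ : Representation ℂ G (Fin n → ℂ)), τ.IsIrreducible →
    ∃ i, Nonempty (τ.Equiv (σ i))

/-- `ρ ≅ ⨁ᵢ (m i) • σ i`, the direct sum of `m i` copies of each `σ i`. -/
def IsDecomposition {G : Type*} [Group G] {Lam : Type*} {S : Lam → Type*}
    [∀ i, AddCommGroup (S i)] [∀ i, Module ℂ (S i)]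
    (σ : ∀ i, Representation ℂ G (S i))
    {W : Type*} [AddCommGroup W] [Module ℂ W] (ρ : Representation ℂ G W) (m : Lam → ℕ) : Prop :=
  Nonempty (ρ.Equiv (Representation.directSum fun p : (Σ i, Fin (m i)) => σ p.1))

open Classical in
/-- The multiplicity of `σ i` as a summand of `ρ`, that is, the coefficient `m i` in a decomposition
`ρ ≅ ⨁ᵢ (m i) • σ i` (which exists and is unique when `ρ` is finite-dimensional, `G` is finite and
`σ` lists the irreducible modules; the value is `0` when there is no such decomposition). -/
def multiplicity {G : Type*} [Group G] {Lam : Type*} {S : Lam → Type*}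
    [∀ i, AddCommGroup (S i)] [∀ i, Module ℂ (S i)]
    (σ : ∀ i, Representation ℂ G (S i))
    {W : Type*} [AddCommGroup W] [Module ℂ W] (ρ : Representation ℂ G W) (i : Lam) : ℕ :=
  if h : ∃ m : Lam → ℕ, IsDecomposition σ ρ m then h.choose i else 0

/-- The adjacency matrix of the representation graph of `ρ`: the entry at `(i, j)` is the number of
edges from `i` to `j`, which is the multiplicity of `σ j` in `σ i ⊗ V`. -/
def adjacencyMatrix {G : Type*} [Group G] {Lam : Type*} {S : Lam → Type*}
    [∀ i, AddCommGroup (S i)] [∀ i, Module ℂ (S i)]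
    (σ : ∀ i, Representation ℂ G (S i))
    {V : Type*} [AddCommGroup V] [Module ℂ V] (ρ : Representation ℂ G V) : Matrix Lam Lam ℕ :=
  Matrix.of fun i j => multiplicity σ ((σ i).tprod ρ) j

/-- The Poincaré series `∑ₖ mₖ tᵏ`, where `mₖ` is the multiplicity of `σ i` in `V^{⊗k}`. -/
def poincareSeries {G : Type*} [Group G] {Lam : Type*} {S : Lam → Type*}
    [∀ i, AddCommGroup (S i)] [∀ i, Module ℂ (S i)]
    (σ : ∀ i, Representation ℂ G (S i))
    {V : Type*} [AddCommGroup V] [Module ℂ V] (ρ : Representation ℂ G V) (i : Lam) :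
    PowerSeries ℂ :=
  PowerSeries.mk fun k => (multiplicity σ (tensorPower ρ k) i : ℂ)

/-- The matrix `I - t A`, with entries in `ℂ⟦t⟧`. -/
def oneSubTMul {Lam : Type*} [DecidableEq Lam] (A : Matrix Lam Lam ℕ) :
    Matrix Lam Lam (PowerSeries ℂ) :=
  1 - (PowerSeries.X : PowerSeries ℂ) • A.map (fun a => (a : PowerSeries ℂ))

/-- `Γ` contains exactly one element of each conjugacy class of `G`. -/
def IsConjClassReps {G : Type*} [Group G] (Γ : Finset G) : Prop :=
  ∀ g : G, ∃! x, x ∈ Γ ∧ IsConj x g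

end PoincareTensor

end

/-! Let `X` be the character table, with rows indexed by irreducibles and columns by `Γ`. Taking
characters of `σ i ⊗ V` gives `A X = X diag(χ_V(g))`. The table is square, as there are as many
irreducibles as conjugacy classes, and invertible, as irreducible characters are independent. Hence
`det (I - tA) = ∏ (1 - χ_V(g) t)` (`det_oneSubTMul_adjacencyMatrix`).

From `V^{⊗(k+1)} = V^{⊗k} ⊗ V`, the row of Poincaré series satisfies `m (I - tA) = e₀`. Self-duality
of `V` makes `A` symmetric, so `m` also solves the column system
(`oneSubTMul_mulVec_poincareSeries`), and Cramer's rule gives the quotient. -/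

noncomputable section

namespace PoincareTensor

open Representation Module
open scoped MonoidAlgebra DirectSum Matrix

/-! ### Complete reducibility -/

section Decomposition

variable {G : Type*} [Group G]

/-- An equivalence of representations, as an isomorphism of modules over the group algebra. -/
def asModuleLinearEquiv {V W : Type*} [AddCommGroup V] [Module ℂ V] [AddCommGroup W] [Module ℂ W]
    {ρ : Representation ℂ G V} {τ : Representation ℂ G W} (e : ρ.Equiv τ) :
    ρ.asModule ≃ₗ[ℂ[G]] τ.asModule :=
  LinearEquiv.ofBijective (IntertwiningMap.equivLinearMapAsModule ρ τ e.toIntertwiningMap)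
    (EquivLike.bijective e)

/-- A finite-dimensional module over the group algebra is the module of a representation on a
coordinate space. -/
theorem exists_coordinate_representation (N : Type*) [AddCommGroup N] [Module ℂ N] [Module ℂ[G] N]
    [IsScalarTower ℂ ℂ[G] N] [FiniteDimensional ℂ N] :
    ∃ (n : ℕ) (τ : Representation ℂ G (Fin n → ℂ)), Nonempty (N ≃ₗ[ℂ[G]] τ.asModule) := by
  let b := (finBasis ℂ N).equivFun
  let τ : Representation ℂ G (Fin (finrank ℂ N) → ℂ) :=
    (b.conjRingEquiv : _ →* _).comp (ofModule' (k := ℂ) (G := G) N)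
  have hτ (g : G) (x : N) : τ g (b x) = b (MonoidAlgebra.single g (1 : ℂ) • x) := by
    simp [τ, LinearEquiv.conjRingEquiv, ofModule']
  refine ⟨_, τ, ⟨{ b with map_smul' := fun r x => ?_ }⟩⟩
  change b (r • x) = τ.asAlgebraHom r (b x)
  induction r using MonoidAlgebra.induction_linear with
  | zero => simp
  | add r s hr hs => simp [add_smul, hr, hs]
  | single g a =>
    rw [asAlgebraHom_single, LinearMap.smul_apply, hτ, ← map_smul, ← smul_assoc]
    simp

variable {Lam : Type*} {S : Lam → Type*} [∀ i, AddCommGroup (S i)] [∀ i, Module ℂ (S i)]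
  {σ : ∀ i, Representation ℂ G (S i)}

theorem IsIrreducibleList.exists_linearEquiv (hσ : IsIrreducibleList σ) (N : Type*)
    [AddCommGroup N] [Module ℂ N] [Module ℂ[G] N] [IsScalarTower ℂ ℂ[G] N] [FiniteDimensional ℂ N]
    [IsSimpleModule ℂ[G] N] : ∃ i, Nonempty (N ≃ₗ[ℂ[G]] (σ i).asModule) := by
  obtain ⟨n, τ, ⟨e⟩⟩ := exists_coordinate_representation (G := G) N
  have : τ.IsIrreducible :=
    (irreducible_iff_isSimpleModule_asModule τ).mpr (IsSimpleModule.congr e.symm)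
  obtain ⟨i, ⟨f⟩⟩ := hσ.exists_equiv n τ this
  exact ⟨i, ⟨e.trans (asModuleLinearEquiv f)⟩⟩

/-- Complete reducibility: a finite-dimensional representation of a finite group is a direct sum of
the listed irreducible representations. -/
theorem IsIrreducibleList.exists_isDecomposition [Finite G] (hσ : IsIrreducibleList σ)
    {W : Type*} [AddCommGroup W] [Module ℂ W] [FiniteDimensional ℂ W] (ρ : Representation ℂ G W) :
    ∃ m : Lam → ℕ, IsDecomposition σ ρ m := by
  classical
  -- Maschke's hypothesis: `|G|` is nonzero in `ℂ`.
  have : NeZero (Nat.card G : ℂ) := ⟨Nat.cast_ne_zero.mpr Nat.card_pos.ne'⟩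
  have : Module.Finite ℂ[G] ρ.asModule := Module.Finite.of_restrictScalars_finite ℂ _ _
  obtain ⟨n, T, e, hT⟩ := IsSemisimpleModule.exists_linearEquiv_fin_dfinsupp ℂ[G] ρ.asModule
  have hfin (p : Fin n) : FiniteDimensional ℂ (T p) :=
    Module.Finite.of_injective ((T p).subtype.restrictScalars ℂ) (T p).injective_subtype
  choose f hf using fun p => hσ.exists_linearEquiv (T p)
  -- The multiplicity of `σ i` is the number of simple summands of type `i`, so the summands are
  -- regrouped by the fibres of `f`.
  let h : Fin n ≃ Σ i, Fin (Fintype.card {p // f p = i}) :=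
    (Equiv.sigmaFiberEquiv f).symm.trans
      (Equiv.sigmaCongrRight fun i => Fintype.equivFin {p // f p = i})
  have hh (k) : f (h.symm k) = k.1 := ((Fintype.equivFin {p // f p = k.1}).symm k.2).2
  have hk (k) : Nonempty (T (h.symm k) ≃ₗ[ℂ[G]] (σ k.1).asModule) := hh k ▸ hf (h.symm k)
  let E : ρ.asModule ≃ₗ[ℂ[G]] ⨁ k, (σ (Sigma.fst k)).asModule :=
    e.trans ((DirectSum.lequivCongrLeft ℂ[G] h).trans
      (DFinsupp.mapRange.linearEquiv fun k => (hk k).some))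
  refine ⟨fun i => Fintype.card {p // f p = i}, ⟨Representation.Equiv.mk
    (ρ.asModuleEquiv.symm.trans (E.restrictScalars ℂ)) fun g => ?_⟩⟩
  ext x k
  have := congrArg (fun z => z k)
    (E.map_smul (MonoidAlgebra.single g (1 : ℂ)) (ρ.asModuleEquiv.symm x))
  simp only [single_smul, one_smul, LinearEquiv.apply_symm_apply] at this
  refine this.trans ?_
  rw [DirectSum.smul_apply, single_smul, one_smul]
  rfl

end Decomposition

/-! ### Trace of a direct sum of maps -/

section DirectSumTrace

theorem trace_directSum_lmap {ι : Type*} [Fintype ι] {M : ι → Type*}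
    [∀ i, AddCommGroup (M i)] [∀ i, Module ℂ (M i)] [∀ i, FiniteDimensional ℂ (M i)]
    (f : ∀ i, M i →ₗ[ℂ] M i) :
    LinearMap.trace ℂ (⨁ i, M i) (DirectSum.lmap f) = ∑ i, LinearMap.trace ℂ (M i) (f i) := by
  classical
  let B : Basis (Σ i, Fin (finrank ℂ (M i))) ℂ (⨁ i, M i) :=
    DFinsupp.basis fun i => finBasis ℂ (M i)
  have hrepr (x : ⨁ i, M i) (i j) : B.repr x ⟨i, j⟩ = (finBasis ℂ (M i)).repr (x i) j := rfl
  have hB (i j) : B ⟨i, j⟩ = DirectSum.lof ℂ ι M i (finBasis ℂ (M i) j) := by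
    apply B.repr.injective
    ext ⟨a, b⟩
    rw [B.repr_self, hrepr]
    obtain rfl | h := eq_or_ne a i
    · simp [DirectSum.lof_apply, Finsupp.single_apply]
    · rw [DirectSum.lof_eq_of, DirectSum.of_eq_of_ne _ _ _ h, map_zero,
        Finsupp.single_eq_of_ne (by grind), Finsupp.zero_apply]
  rw [LinearMap.trace_eq_matrix_trace ℂ B]
  simp_rw [fun i => LinearMap.trace_eq_matrix_trace ℂ (finBasis ℂ (M i)) (f i), Matrix.trace,
    Matrix.diag, LinearMap.toMatrix_apply, Fintype.sum_sigma, hB, DirectSum.lmap_lof, hrepr,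
    DirectSum.lof_apply]

end DirectSumTrace

/-! ### Orthogonality of characters and multiplicities -/

section Characters

variable {G : Type*} [Group G]
variable {Lam : Type*} {S : Lam → Type*} [∀ i, AddCommGroup (S i)] [∀ i, Module ℂ (S i)]
  {σ : ∀ i, Representation ℂ G (S i)}

theorem IsIrreducibleList.sum_character_mul_character_inv [Fintype G] [DecidableEq Lam]
    (hσ : IsIrreducibleList σ) (i j : Lam) :
    ∑ g, (σ i).character g * (σ j).character g⁻¹ = if i = j then (Nat.card G : ℂ) else 0 := by
  have h0 : (Nat.card G : ℂ) ≠ 0 := Nat.cast_ne_zero.mpr Nat.card_pos.ne'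
  let : Invertible (Nat.card G : ℂ) := invertibleOfNonzero h0
  have := hσ.finiteDimensional i
  have := hσ.finiteDimensional j
  have := hσ.irreducible i
  have := hσ.irreducible j
  have h := char_orthonormal (σ i) (σ j)
  have hij : Nonempty ((σ j).Equiv (σ i)) ↔ i = j :=
    ⟨fun e => (hσ.eq_of_equiv _ _ e).symm, by rintro rfl; exact ⟨.refl _⟩⟩
  rw [inv_mul_eq_iff_eq_mul₀ h0] at h
  rw [h]
  simp [hij]

/-- Pairing a linear relation with `χ_j(g⁻¹)` isolates the coefficient of `χ_j`, up to the nonzero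
factor `|G|`. -/
theorem IsIrreducibleList.linearIndependent_character [Finite G] (hσ : IsIrreducibleList σ) :
    LinearIndependent ℂ fun i => (σ i).character := by
  classical
  have := Fintype.ofFinite G
  have h0 : (Nat.card G : ℂ) ≠ 0 := Nat.cast_ne_zero.mpr Nat.card_pos.ne'
  rw [linearIndependent_iff']
  intro s a ha j hj
  have h : ∑ g, (∑ i ∈ s, a i • (σ i).character) g * (σ j).character g⁻¹ = 0 := by
    rw [ha]; simp
  simp only [Finset.sum_apply, Pi.smul_apply, smul_eq_mul, Finset.sum_mul, mul_assoc] at h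
  rw [Finset.sum_comm] at h
  simp_rw [← Finset.mul_sum, hσ.sum_character_mul_character_inv] at h
  simpa [hj, h0] using h

theorem IsIrreducibleList.finite [Finite G] (hσ : IsIrreducibleList σ) : Finite Lam :=
  hσ.linearIndependent_character.finite_of_isNoetherian

theorem IsDecomposition.character_eq [Fintype Lam] (hσ : IsIrreducibleList σ) {W : Type*}
    [AddCommGroup W] [Module ℂ W] {ρ : Representation ℂ G W} {m : Lam → ℕ}
    (h : IsDecomposition σ ρ m) (g : G) :
    ρ.character g = ∑ i, (m i : ℂ) * (σ i).character g := by
  obtain ⟨e⟩ := h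
  have := hσ.finiteDimensional
  rw [char_iso e]
  simp only [character, directSum_apply]
  rw [trace_directSum_lmap, Fintype.sum_sigma]
  refine Finset.sum_congr rfl fun i _ => (Finset.sum_const (s := Finset.univ)
    (LinearMap.trace ℂ (S i) (σ i g))).trans ?_
  rw [Finset.card_univ, Fintype.card_fin, nsmul_eq_mul]

theorem IsIrreducibleList.character_eq_sum_multiplicity [Finite G] [Fintype Lam]
    (hσ : IsIrreducibleList σ) {W : Type*} [AddCommGroup W] [Module ℂ W] [FiniteDimensional ℂ W]
    (ρ : Representation ℂ G W) (g : G) :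
    ρ.character g = ∑ i, (multiplicity σ ρ i : ℂ) * (σ i).character g := by
  have h := hσ.exists_isDecomposition ρ
  rw [h.choose_spec.character_eq hσ]
  simp [multiplicity, h]

/-- Lets identities between multiplicities be checked on characters. -/
theorem IsIrreducibleList.ext_character [Finite G] [Fintype Lam] (hσ : IsIrreducibleList σ)
    {a b : Lam → ℂ} (h : ∀ g, ∑ i, a i * (σ i).character g = ∑ i, b i * (σ i).character g) :
    a = b := by
  have := Fintype.linearIndependent_iff.mp hσ.linearIndependent_character (a - b) (by
    ext g
    simp [sub_mul, h])
  ext i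
  simpa [sub_eq_zero] using this i

theorem IsIrreducibleList.multiplicity_eq [Fintype G] [Fintype Lam]
    (hσ : IsIrreducibleList σ) {W : Type*} [AddCommGroup W] [Module ℂ W] [FiniteDimensional ℂ W]
    (ρ : Representation ℂ G W) (i : Lam) :
    (Nat.card G : ℂ) * multiplicity σ ρ i = ∑ g, ρ.character g * (σ i).character g⁻¹ := by
  classical
  simp_rw [hσ.character_eq_sum_multiplicity ρ, Finset.sum_mul, mul_assoc]
  rw [Finset.sum_comm]
  simp_rw [← Finset.mul_sum, hσ.sum_character_mul_character_inv]
  simp [mul_comm]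

end Characters

/-! ### Class functions; irreducibles are as many as conjugacy classes -/

section ClassFunctions

variable {G : Type*} [Group G] [Fintype G]

theorem comp_sum_smul_of_conj_invariant {V : Type*} [AddCommGroup V] [Module ℂ V]
    (ρ : Representation ℂ G V) {f : G → ℂ} (hf : ∀ g h, f (h * g * h⁻¹) = f g) (h : G) :
    (∑ g, f g • ρ g) ∘ₗ ρ h = ρ h ∘ₗ ∑ g, f g • ρ g := by
  simp only [← Module.End.mul_eq_comp, Finset.sum_mul, Finset.mul_sum, smul_mul_assoc,
    mul_smul_comm, ← map_mul]
  refine (Fintype.sum_equiv (MulAut.conj h).toEquiv _ _ fun g => ?_).symm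
  simp [hf]

/-- The sum commutes with `G`, so by Schur's lemma it is a scalar `c`; its trace `c * dim V`
vanishes and `dim V ≠ 0`. -/
theorem sum_smul_eq_zero_of_isIrreducible {V : Type*} [AddCommGroup V] [Module ℂ V]
    [FiniteDimensional ℂ V] (ρ : Representation ℂ G V) [ρ.IsIrreducible] {f : G → ℂ}
    (hf : ∀ g h, f (h * g * h⁻¹) = f g) (h0 : ∑ g, f g * ρ.character g = 0) :
    ∑ g, f g • ρ g = 0 := by
  let F : IntertwiningMap ρ ρ := ⟨∑ g, f g • ρ g, comp_sum_smul_of_conj_invariant ρ hf⟩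
  obtain ⟨c, hc⟩ := IsIrreducible.algebraMap_intertwiningMap_bijective_of_isAlgClosed.2 F
  have hF : ∑ g, f g • ρ g = c • LinearMap.id := (congrArg IntertwiningMap.toLinearMap hc).symm
  have htr : c * finrank ℂ V = 0 := by
    have := congrArg (LinearMap.trace ℂ V) hF
    simp only [map_sum, map_smul, smul_eq_mul, LinearMap.trace_id] at this
    rw [← this, ← h0]
    rfl
  have : Nontrivial V := by
    by_contra hV
    rw [not_nontrivial_iff_subsingleton] at hV
    exact bot_ne_top (α := Subrepresentation ρ) (SetLike.ext fun x => by
      rw [Subsingleton.elim x 0]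
      exact ⟨fun _ => Submodule.zero_mem (⊤ : Subrepresentation ρ).toSubmodule,
        fun _ => Submodule.zero_mem (⊥ : Subrepresentation ρ).toSubmodule⟩)
  have hn : (finrank ℂ V : ℂ) ≠ 0 := Nat.cast_ne_zero.mpr finrank_pos.ne'
  rw [hF, (mul_eq_zero.mp htr).resolve_right hn, zero_smul]

variable {Lam : Type*} {S : Lam → Type*} [∀ i, AddCommGroup (S i)] [∀ i, Module ℂ (S i)]
  {σ : ∀ i, Representation ℂ G (S i)}

/-- A class function orthogonal to every irreducible character vanishes. -/
theorem IsIrreducibleList.eq_zero_of_sum_mul_character (hσ : IsIrreducibleList σ) {f : G → ℂ}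
    (hf : ∀ g h, f (h * g * h⁻¹) = f g) (h0 : ∀ i, ∑ g, f g * (σ i).character g = 0) : f = 0 := by
  classical
  have hirr (i) : ∑ g, f g • σ i g = 0 := by
    have := hσ.finiteDimensional i
    have := hσ.irreducible i
    exact sum_smul_eq_zero_of_isIrreducible (σ i) hf (h0 i)
  -- Vanishing on irreducibles passes to the regular representation, where applying `∑ f g • g` to
  -- the identity recovers `f`.
  obtain ⟨m, ⟨e⟩⟩ := hσ.exists_isDecomposition (leftRegular ℂ G)
  have hreg (x) : ∑ g, f g • leftRegular ℂ G g x = 0 := by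
    apply (EquivLike.injective e)
    rw [map_sum, map_zero]
    ext k
    have := congrArg (fun T : Module.End ℂ (S k.1) => T (e x k)) (hirr k.1)
    simp only [LinearMap.sum_apply, LinearMap.smul_apply, LinearMap.zero_apply] at this
    rw [DirectSum.zero_apply, ← this, DFinsupp.finsetSum_apply]
    refine Finset.sum_congr rfl fun g _ => ?_
    rw [map_smul, DirectSum.smul_apply]
    congr 1
    exact congrArg (fun z : ⨁ k, S (Sigma.fst k) => z k)
      (IntertwiningMap.isIntertwining _ _ e.toIntertwiningMap g x)
  ext g
  have := congrArg (fun z => MonoidAlgebra.coeff z g) (hreg (MonoidAlgebra.single 1 1))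
  simpa [Finsupp.single_apply] using this

theorem IsConjClassReps.exists_equiv [Fintype Lam] {Γ : Finset G} (hΓ : IsConjClassReps Γ)
    (hσ : IsIrreducibleList σ) : Nonempty (Lam ≃ Γ) := by
  classical
  choose r hr hr' using hΓ
  have hrr {x} (hx : x ∈ Γ) : r x = x := (hr' x x ⟨hx, .refl x⟩).symm
  have hconj {g h : G} (hgh : IsConj g h) : r g = r h :=
    hr' h _ ⟨(hr g).1, (hr g).2.trans hgh⟩
  let R (g : G) : Γ := ⟨r g, (hr g).1⟩
  -- Characters are class functions, so they stay independent when restricted to `Γ`.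
  have hle : Fintype.card Lam ≤ Fintype.card Γ := by
    have : LinearIndependent ℂ fun i (γ : Γ) => (σ i).character γ := by
      rw [Fintype.linearIndependent_iff]
      intro a ha
      refine Fintype.linearIndependent_iff.mp hσ.linearIndependent_character a ?_
      ext g
      have := congrFun ha (R g)
      have hχ (i) : (σ i).character (r g) = (σ i).character g := by
        obtain ⟨c, hc⟩ := isConj_iff.mp (hr g).2
        exact (char_conj (σ i) (r g) c).symm.trans (congrArg _ hc)
      simpa [R, hχ] using this
    simpa using this.fintype_card_le_finrank
  -- Extend a function on `Γ` to a class function and pair it with all irreducible characters: this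
  -- map is injective.
  have hge : Fintype.card Γ ≤ Fintype.card Lam := by
    let T : (Γ → ℂ) →ₗ[ℂ] (Lam → ℂ) :=
      { toFun := fun c i => ∑ g, c (R g) * (σ i).character g
        map_add' := fun c d => by ext i; simp [add_mul, Finset.sum_add_distrib]
        map_smul' := fun c d => by ext i; simp [mul_assoc, Finset.mul_sum] }
    have hT : Function.Injective T := by
      rw [← LinearMap.ker_eq_bot, LinearMap.ker_eq_bot']
      intro c hc
      have := hσ.eq_zero_of_sum_mul_character (f := fun g => c (R g))
        (fun g h => by
          have : R (h * g * h⁻¹) = R g := Subtype.ext (hconj (isConj_iff.mpr ⟨h, rfl⟩).symm)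
          rw [this]) (fun i => congrFun hc i)
      ext γ
      have hγ : R γ = γ := Subtype.ext (hrr γ.2)
      simpa [hγ] using congrFun this γ
    simpa using LinearMap.finrank_le_finrank_of_injective hT
  exact Fintype.card_eq.mp (hle.antisymm hge)

end ClassFunctions

/-! ### Characters of tensor powers -/

section TensorPower

variable {G V : Type*} [Group G] [AddCommGroup V] [Module ℂ V] [FiniteDimensional ℂ V]

theorem tensorPower_character (ρ : Representation ℂ G V) (k : ℕ) (g : G) :
    (tensorPower ρ k).character g = ρ.character g ^ k := by
  classical
  let b := finBasis ℂ V
  change LinearMap.trace ℂ _ (PiTensorProduct.map fun _ => ρ g) = LinearMap.trace ℂ V (ρ g) ^ k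
  rw [LinearMap.trace_eq_matrix_trace ℂ b, LinearMap.trace_eq_matrix_trace ℂ
    (Basis.piTensorProduct fun _ : Fin k => b)]
  simp only [Matrix.trace, Matrix.diag, LinearMap.toMatrix_apply, Basis.piTensorProduct_apply,
    PiTensorProduct.map_tprod, Basis.piTensorProduct_repr_tprod_apply]
  rw [← Fintype.prod_sum fun (_ : Fin k) j => b.repr (ρ g (b j)) j]
  simp

end TensorPower

/-! ### The adjacency matrix, its linear system and its determinant -/

section Adjacency

variable {G : Type*} [Group G] [Finite G]
variable {Lam : Type*} [Fintype Lam] {S : Lam → Type*} [∀ i, AddCommGroup (S i)]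
  [∀ i, Module ℂ (S i)] {σ : ∀ i, Representation ℂ G (S i)}
  {V : Type*} [AddCommGroup V] [Module ℂ V] [FiniteDimensional ℂ V] {ρ : Representation ℂ G V}

theorem IsIrreducibleList.sum_adjacencyMatrix_mul_character (hσ : IsIrreducibleList σ) (i : Lam)
    (g : G) : ∑ j, (adjacencyMatrix σ ρ i j : ℂ) * (σ j).character g =
      (σ i).character g * ρ.character g := by
  have := hσ.finiteDimensional i
  have := hσ.character_eq_sum_multiplicity ((σ i).tprod ρ) g
  rw [char_tensor] at this
  exact this.symm

/-- `|G| a_{ij} = ∑ χ_i(g) χ_V(g) χ_j(g⁻¹)`, and self-duality gives `χ_V(g⁻¹) = χ_V(g)`;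
substituting `g⁻¹` for `g` swaps `i` and `j`. -/
theorem IsIrreducibleList.adjacencyMatrix_isSymm (hσ : IsIrreducibleList σ)
    (hdual : Nonempty (ρ.dual.Equiv ρ)) : (adjacencyMatrix σ ρ).IsSymm := by
  have := Fintype.ofFinite G
  have hfin := hσ.finiteDimensional
  obtain ⟨e⟩ := hdual
  have hρ (g) : ρ.character g⁻¹ = ρ.character g := by rw [← char_dual, char_iso e]
  have h0 : (Nat.card G : ℂ) ≠ 0 := Nat.cast_ne_zero.mpr Nat.card_pos.ne'
  ext i j
  apply Nat.cast_injective (R := ℂ)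
  apply mul_left_cancel₀ h0
  simp only [Matrix.transpose_apply, adjacencyMatrix, Matrix.of_apply]
  rw [hσ.multiplicity_eq, hσ.multiplicity_eq, ← Equiv.sum_comp (Equiv.inv G)]
  refine Finset.sum_congr rfl fun g _ => ?_
  simp only [char_tensor, Pi.mul_apply, Equiv.inv_apply, inv_inv, hρ]
  ring

theorem IsIrreducibleList.multiplicity_tensorPower_zero [DecidableEq Lam]
    (hσ : IsIrreducibleList σ) {o : Lam}
    (ho : Nonempty ((σ o).Equiv (Representation.trivial ℂ G ℂ))) (i : Lam) :
    (multiplicity σ (tensorPower ρ 0) i : ℂ) = (Pi.single o 1 : Lam → ℂ) i := by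
  obtain ⟨e⟩ := ho
  refine congrFun (hσ.ext_character (a := fun i => (multiplicity σ (tensorPower ρ 0) i : ℂ))
    fun g => ?_) i
  rw [← hσ.character_eq_sum_multiplicity, tensorPower_character]
  have hχ : (σ o).character g = 1 := by
    rw [char_iso e]
    simp [character, Representation.trivial]
  simp [Pi.single_apply, hχ]

theorem IsIrreducibleList.multiplicity_tensorPower_succ (hσ : IsIrreducibleList σ) (k : ℕ)
    (j : Lam) : (multiplicity σ (tensorPower ρ (k + 1)) j : ℂ) =
      ∑ i, (multiplicity σ (tensorPower ρ k) i : ℂ) * adjacencyMatrix σ ρ i j := by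
  refine congrFun (hσ.ext_character
    (a := fun j => (multiplicity σ (tensorPower ρ (k + 1)) j : ℂ))
    (b := fun j => ∑ i, (multiplicity σ (tensorPower ρ k) i : ℂ) * adjacencyMatrix σ ρ i j)
    fun g => ?_) j
  rw [← hσ.character_eq_sum_multiplicity, tensorPower_character]
  simp_rw [Finset.sum_mul, mul_assoc]
  rw [Finset.sum_comm]
  simp_rw [← Finset.mul_sum, hσ.sum_adjacencyMatrix_mul_character, ← mul_assoc]
  rw [← Finset.sum_mul, ← hσ.character_eq_sum_multiplicity, tensorPower_character, pow_succ]

variable [DecidableEq Lam]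

theorem IsIrreducibleList.oneSubTMul_mulVec_poincareSeries (hσ : IsIrreducibleList σ)
    (hdual : Nonempty (ρ.dual.Equiv ρ)) {o : Lam}
    (ho : Nonempty ((σ o).Equiv (Representation.trivial ℂ G ℂ))) :
    oneSubTMul (adjacencyMatrix σ ρ) *ᵥ poincareSeries σ ρ = Pi.single o 1 := by
  rw [oneSubTMul, Matrix.sub_mulVec, Matrix.one_mulVec, Matrix.smul_mulVec, sub_eq_iff_eq_add]
  ext j k
  have hX : ((Pi.single o 1 : Lam → PowerSeries ℂ) j) =
      PowerSeries.C ((Pi.single o 1 : Lam → ℂ) j) := by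
    by_cases h : j = o <;> simp [h]
  rw [Pi.add_apply, Pi.smul_apply, smul_eq_mul, map_add, hX]
  cases k with
  | zero =>
    simp [poincareSeries, hσ.multiplicity_tensorPower_zero ho]
  | succ k =>
    rw [PowerSeries.coeff_succ_X_mul, PowerSeries.coeff_C, if_neg k.succ_ne_zero, zero_add,
      Matrix.mulVec, dotProduct, map_sum, poincareSeries, PowerSeries.coeff_mk,
      hσ.multiplicity_tensorPower_succ]
    refine Finset.sum_congr rfl fun i _ => ?_
    rw [Matrix.map_apply, ← map_natCast (PowerSeries.C (R := ℂ)), PowerSeries.coeff_C_mul,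
      -- The recursion sums over the row index of `A`, while `*ᵥ` sums over the column index;
      -- symmetry reconciles them.
      poincareSeries, PowerSeries.coeff_mk, (hσ.adjacencyMatrix_isSymm hdual).apply i j, mul_comm]

theorem IsIrreducibleList.det_oneSubTMul_adjacencyMatrix (hσ : IsIrreducibleList σ)
    {Γ : Finset G} (hΓ : IsConjClassReps Γ) :
    (oneSubTMul (adjacencyMatrix σ ρ)).det =
      ∏ g ∈ Γ, (1 - PowerSeries.C (ρ.character g) * PowerSeries.X) := by
  have := Fintype.ofFinite G
  obtain ⟨e⟩ := hΓ.exists_equiv hσ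
  -- The bijection `e` is arbitrary: it only makes the character table square over one index type.
  let X : Matrix Lam Lam ℂ := Matrix.of fun i j => (σ i).character (e j : G)
  have hX : IsUnit X := by
    rw [← Matrix.linearIndependent_rows_iff_isUnit, Fintype.linearIndependent_iff]
    intro a ha
    refine Fintype.linearIndependent_iff.mp hσ.linearIndependent_character a ?_
    ext g
    obtain ⟨γ, ⟨hγ, hc⟩, -⟩ := hΓ g
    obtain ⟨c, hc⟩ := isConj_iff.mp hc
    have hχ (i) : (σ i).character γ = (σ i).character g :=
      (char_conj (σ i) γ c).symm.trans (congrArg _ hc)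
    simpa [X, hχ] using congrFun ha (e.symm ⟨γ, hγ⟩)
  let Y := X.map (PowerSeries.C (R := ℂ))
  have hY : Y.det ≠ 0 := by
    have h := (Matrix.isUnit_iff_isUnit_det X).mp hX
    have : Y.det = PowerSeries.C X.det := (RingHom.map_det _ X).symm
    rw [this]
    exact (h.map PowerSeries.C).ne_zero
  have key : oneSubTMul (adjacencyMatrix σ ρ) * Y =
      Y * Matrix.diagonal fun j => 1 - PowerSeries.C (ρ.character (e j : G)) * PowerSeries.X := by
    rw [oneSubTMul, sub_mul, one_mul, Matrix.smul_mul]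
    ext1 i j
    rw [Matrix.mul_diagonal, Matrix.sub_apply, Matrix.smul_apply, Matrix.mul_apply]
    have h := congrArg (PowerSeries.C (R := ℂ))
      (hσ.sum_adjacencyMatrix_mul_character (ρ := ρ) i (e j : G))
    simp only [map_sum, map_mul, map_natCast] at h
    simp only [Matrix.map_apply, Y, X, Matrix.of_apply, smul_eq_mul]
    rw [h]
    ring
  have hdet := congrArg Matrix.det key
  rw [Matrix.det_mul, Matrix.det_mul, mul_comm, Matrix.det_diagonal] at hdet
  rw [mul_left_cancel₀ hY hdet, ← Finset.prod_coe_sort Γ]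
  exact Equiv.prod_comp e fun γ : Γ => 1 - PowerSeries.C (ρ.character (γ : G)) * PowerSeries.X

end Adjacency

end PoincareTensor

end

theorem theorem2p1 {G : Type*} [Group G] [Finite G]
    {Lam : Type*} {S : Lam → Type*} [∀ i, AddCommGroup (S i)] [∀ i, Module ℂ (S i)]
    (σ : ∀ i, Representation ℂ G (S i)) (hσ : PoincareTensor.IsIrreducibleList σ)
    (o : Lam) (ho : Nonempty ((σ o).Equiv (Representation.trivial ℂ G ℂ)))
    {V : Type*} [AddCommGroup V] [Module ℂ V] [FiniteDimensional ℂ V]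
    (ρ : Representation ℂ G V) (hfaithful : Function.Injective ρ)
    (hdual : Nonempty (ρ.dual.Equiv ρ))
    (Γ : Finset G) (hΓ : PoincareTensor.IsConjClassReps Γ) :
    Finite Lam ∧ ∀ [Fintype Lam] [DecidableEq Lam],
      let D : Matrix Lam Lam (PowerSeries ℂ) :=
        PoincareTensor.oneSubTMul (PoincareTensor.adjacencyMatrix σ ρ)
      let M : Lam → Matrix Lam Lam (PowerSeries ℂ) := fun μ => D.updateCol μ (Pi.single o 1)
      let P : PowerSeries ℂ :=
        ∏ g ∈ Γ, (1 - PowerSeries.C (ρ.character g) * PowerSeries.X)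
      IsUnit D.det ∧
      (∀ μ, PoincareTensor.poincareSeries σ ρ μ = (M μ).det * D.det⁻¹) ∧
      D.det = P ∧
      (∀ μ, PoincareTensor.poincareSeries σ ρ μ = (M μ).det * P⁻¹) := by
  refine ⟨hσ.finite, ?_⟩
  intro _ _ D M P
  have hdet : D.det = P := hσ.det_oneSubTMul_adjacencyMatrix hΓ
  -- Constant term `1` makes `P⁻¹` a genuine inverse; the inverse of a series with zero constant
  -- term is `0` by convention.
  have hP : PowerSeries.constantCoeff P = 1 := by simp [P, map_prod]
  have hser (μ) : PoincareTensor.poincareSeries σ ρ μ = (M μ).det * P⁻¹ := by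
    -- Cramer's rule: with `D m = e₀`, `adj(D) e₀ = adj(D) D m = det(D) m`.
    rw [PowerSeries.eq_mul_inv_iff_mul_eq (hP ▸ one_ne_zero), ← hdet, ← Matrix.cramer_apply,
      ← hσ.oneSubTMul_mulVec_poincareSeries hdual ho, Matrix.cramer_eq_adjugate_mulVec,
      Matrix.mulVec_mulVec, Matrix.adjugate_mul, Matrix.smul_mulVec, Matrix.one_mulVec,
      Pi.smul_apply, smul_eq_mul, mul_comm]
  refine ⟨?_, fun μ => hdet ▸ hser μ, hdet, hser⟩
  rw [hdet, PowerSeries.isUnit_iff_constantCoeff, hP]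
  exact isUnit_one
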